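/- Let $V$ be a countable set with a quasi-transitive (left) action of a locally compact group $\Gamma$ with left Haar measure $|\cdot|$, such that every stabilizer $\Gamma_x=\{\gamma\in\Gamma:\gamma x=x\}$, $x\in V$, is Borel measurable with $m(x):=|\Gamma_x|<\infty$. Let $\{o_1,\dots,o_L\}$ be a complete set of representatives of $\Gamma\backslash V$. Let $(\Xi,\mathcal F,\mathbf P)$ be a measure space on which $\Gamma$ acts by measurable maps preserving $\mathbf P$, and write $\mathbf E[f]=\int_\Xi f\,d\mathbf P$. Let $q:\Xi\times V\times V\to[0,1]$, $(\xi,x,y)\mapsto q_\xi(x,y)$, be a $\Gamma$-invariant random environment: $q$ is measurable, $\sum_{y\in V}q_\xi(x,y)=1$ for all $\xi,x$, and $q_{\gamma\xi}(\gamma x,\gamma y)=q_\xi(x,y)$ for all $\gamma\in\Gamma$. Let $\nu:\Xi\times V\to[0,\infty)$, $(\xi,x)\mapsto\nu_\xi(x)$, be measurable and $\Gamma$-invariant ($\nu_{\gamma\xi}(\gamma x)=\nu_\xi(x)$), and suppose that for each $\xi\in\Xi$ the function $x\mapsto m(x)\nu_\xi(x)$ is a stationary measure for the Markov chain determined by $q_\xi$,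 i.e. $\sum_{x\in V}m(x)\nu_\xi(x)q_\xi(x,y)=m(y)\nu_\xi(y)$ for all $y\in V$ (its total mass may be infinite). Define $$q_\xi^{\leftarrow}(x_1,x_2):=\frac{\nu_\xi(x_2)m(x_2)}{\nu_\xi(x_1)m(x_1)}\,q_\xi(x_2,x_1)\quad\text{if }\nu_\xi(x_1)>0,\qquad q_\xi^{\leftarrow}(x_1,x_2):=\mathbf 1_{\{x_1=x_2\}}\quad\text{if }\nu_\xi(x_1)=0 .$$ Then $q^{\leftarrow}$ is again a random environment (it is measurable, takes values in $[0,1]$, and $\sum_{x_2\in V}q_\xi^{\leftarrow}(x_1,x_2)=1$ for all $\xi,x_1$), and it is $\Gamma$-invariant. For $(\xi,x)\in\Xi\times V$ let $\theta_\xi^x$ be the law of the two-sided random walk $\widehat w\in V^{\mathbb Z}$ with $\widehat w(0)=x$ such that $(\widehat w(n))_{n\ge0}$ is the Markov chain started at $x$ with transition probabilities $q_\xi$ and $(\widehat w(-n))_{n\ge0}$ is an independent Markov chain started at $x$ with transition probabilities $q_\xi^{\leftarrow}$. Let $\Theta_x$ be the joint law of $(\xi,\widehat w)$ biased by $\nu_\xi(x)$,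 that is, $\Theta_x(A)=\int_\Xi\nu_\xi(x)\,\theta_\xi^x(\{\widehat w:(\xi,\widehat w)\in A\})\,d\mathbf P(\xi)$ for measurable $A\subset\Xi\times V^{\mathbb Z}$, and put $\mathbf\Theta:=\sum_{i=1}^L\Theta_{o_i}$. Let $\Gamma$ act on $\Xi\times V^{\mathbb Z}$ by $\gamma(\xi,\widehat w)=(\gamma\xi,\gamma\widehat w)$ with $(\gamma\widehat w)(n)=\gamma(\widehat w(n))$, let $\mathcal I_{\mathbb Z}$ be the $\sigma$-field of $\Gamma$-invariant measurable subsets of $\Xi\times V^{\mathbb Z}$, and let $\mathcal T(\xi,\widehat w)=(\xi,\widehat w(\cdot+1))$. Then the restriction of $\mathbf\Theta$ to $\mathcal I_{\mathbb Z}$ is a $\mathcal T$-invariant measure: $\mathcal T^{-1}A\in\mathcal I_{\mathbb Z}$ and $\mathbf\Theta(\mathcal T^{-1}A)=\mathbf\Theta(A)$ for every $A\in\mathcal I_{\mathbb Z}$. If moreover $\sum_{i=1}^L\mathbf E[\nu_\xi(o_i)]=1$, then $\mathbf\Theta$ is a probability measure. -/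

import Mathlib

open MeasureTheory ProbabilityTheory
open scoped NNReal ENNReal

noncomputable section

namespace TwoSidedWalk

/-! ### Markov chains on a countable set and their trajectories -/

section Glue

variable {V : Type*}

/-- The two-sided path `ŵ` with `ŵ n = w n` and `ŵ (-n) = w' n` for `n ≥ 0` (where `w` and `w'`
have the same starting point, so that there is no conflict at `0`). -/
def glue (w : (ℕ → V) × (ℕ → V)) : ℤ → V
  | Int.ofNat n => w.1 n
  | Int.negSucc n => w.2 (n + 1)

theorem measurable_glue [MeasurableSpace V] : Measurable (glue : (ℕ → V) × (ℕ → V) → ℤ → V) := by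
  refine measurable_pi_lambda _ fun k => ?_
  cases k with
  | ofNat n => exact (measurable_pi_apply n).comp measurable_fst
  | negSucc n => exact (measurable_pi_apply (n + 1)).comp measurable_snd

end Glue

section Chain

variable {V : Type*} [Countable V] [MeasurableSpace V] [MeasurableSingletonClass V]

/-- The Markov kernel on `V` with transition probabilities `p x y`. -/
def chainKernel (p : V → V → ℝ≥0) : Kernel V V where
  toFun x := Measure.sum fun y => (p x y : ℝ≥0∞) • Measure.dirac y
  measurable' := measurable_of_countable _

theorem chainKernel_singleton (p : V → V → ℝ≥0) (x y : V) :
    chainKernel p x {y} = p x y := by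
  change (Measure.sum fun z => (p x z : ℝ≥0∞) • Measure.dirac z) {y} = _
  rw [Measure.sum_apply _ (measurableSet_singleton y), tsum_eq_single y]
  · simp
  · intro z hz
    simp [hz]

theorem isMarkovKernel_chainKernel {p : V → V → ℝ≥0} (hp : ∀ x, HasSum (p x) 1) :
    IsMarkovKernel (chainKernel p) := by
  refine ⟨fun x => ⟨?_⟩⟩
  change (Measure.sum fun z => (p x z : ℝ≥0∞) • Measure.dirac z) Set.univ = _
  rw [Measure.sum_apply _ MeasurableSet.univ]
  simp only [Measure.smul_apply, measure_univ, smul_eq_mul, mul_one]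
  rw [← ENNReal.coe_tsum (hp x).summable, (hp x).tsum_eq, ENNReal.coe_one]

/-- The same kernel, fed with the path up to time `n` and looking only at its last vertex. -/
def pathKernel (p : V → V → ℝ≥0) (n : ℕ) : Kernel (Finset.Iic n → V) V :=
  (chainKernel p).comap (fun h => h ⟨n, Finset.mem_Iic.2 le_rfl⟩) (measurable_pi_apply _)

theorem isMarkovKernel_pathKernel {p : V → V → ℝ≥0} (hp : ∀ x, HasSum (p x) 1) (n : ℕ) :
    IsMarkovKernel (pathKernel p n) := by
  have := isMarkovKernel_chainKernel hp
  unfold pathKernel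
  infer_instance

/-- The law on `V^ℕ` of the trajectory of the Markov chain started at `x` with transition
probabilities `p` (Ionescu-Tulcea). -/
def walkLaw (p : V → V → ℝ≥0) (hp : ∀ x, HasSum (p x) 1) (x : V) : Measure (ℕ → V) :=
  have := isMarkovKernel_pathKernel hp
  Kernel.traj (X := fun _ => V) (pathKernel p) 0 (fun _ => x)

instance (p : V → V → ℝ≥0) (hp : ∀ x, HasSum (p x) 1) (x : V) :
    IsProbabilityMeasure (walkLaw p hp x) := by
  have := isMarkovKernel_pathKernel hp
  unfold walkLaw
  infer_instance

/-- The law on `V^ℤ` of the two-sided walk started at `x`: the forward path is a Markov chain with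
transition probabilities `p`, the backward path an independent Markov chain with transition
probabilities `r`, both started at `x`. -/
def twoSidedLaw (p : V → V → ℝ≥0) (hp : ∀ x, HasSum (p x) 1)
    (r : V → V → ℝ≥0) (hr : ∀ x, HasSum (r x) 1) (x : V) : Measure (ℤ → V) :=
  ((walkLaw p hp x).prod (walkLaw r hr x)).map glue

instance (p : V → V → ℝ≥0) (hp : ∀ x, HasSum (p x) 1)
    (r : V → V → ℝ≥0) (hr : ∀ x, HasSum (r x) 1) (x : V) :
    IsProbabilityMeasure (twoSidedLaw p hp r hr x) :=
  Measure.isProbabilityMeasure_map measurable_glue.aemeasurable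

variable {Ξ : Type*} [MeasurableSpace Ξ]

theorem measurable_partialTraj {p : Ξ → V → V → ℝ≥0} (hp : ∀ ξ x, HasSum (p ξ x) 1)
    (hm : ∀ x y, Measurable fun ξ => p ξ x y) (x : V) (n : ℕ) :
    ∀ B : Set (Finset.Iic n → V), MeasurableSet B → Measurable fun ξ =>
      Kernel.partialTraj (X := fun _ => V) (pathKernel (p ξ)) 0 n (fun _ => x) B := by
  induction n with
  | zero =>
    intro B hB
    simp only [Kernel.partialTraj_self]
    exact measurable_const
  | succ n ih =>
    intro B hB
    have key : ∀ ξ, Kernel.partialTraj (X := fun _ => V) (pathKernel (p ξ)) 0 (n + 1)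
        (fun _ => x) B = ∑' h : (Finset.Iic n → V),
          Kernel.partialTraj (X := fun _ => V) (pathKernel (p ξ)) n (n + 1) h B *
          Kernel.partialTraj (X := fun _ => V) (pathKernel (p ξ)) 0 n (fun _ => x) {h} := by
      intro ξ
      rw [Kernel.partialTraj_succ_eq_comp (Nat.zero_le n)]
      erw [Kernel.comp_apply' _ _ _ hB]
      exact lintegral_countable' _
    simp_rw [key]
    refine Measurable.tsum fun h => Measurable.mul ?_ (ih _ (measurableSet_singleton h))
    have key2 : ∀ ξ, Kernel.partialTraj (X := fun _ => V) (pathKernel (p ξ)) n (n + 1) h B =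
        ∑' y : V, (p ξ (h ⟨n, Finset.mem_Iic.2 le_rfl⟩) y : ℝ≥0∞) * 
          Set.indicator {y : V | IicProdIoc (X := fun _ => V) n (n + 1)
            (h, MeasurableEquiv.piSingleton (X := fun _ => V) n y) ∈ B} 1 y := by
      intro ξ
      have := isMarkovKernel_pathKernel (hp ξ)
      have hf : Measurable fun y : V => IicProdIoc (X := fun _ => V) n (n + 1)
          (h, MeasurableEquiv.piSingleton (X := fun _ => V) n y) := measurable_of_countable _
      have hB' := measurable_IicProdIoc (X := fun _ : ℕ => V) (m := n) (n := n + 1) hB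
      rw [Kernel.partialTraj_succ_self]
      erw [Kernel.map_apply' _ measurable_IicProdIoc _ hB, Kernel.id_prod_apply' _ _ hB',
        Kernel.map_apply' _ (MeasurableEquiv.measurable _) _ (measurable_prodMk_left hB')]
      change (Measure.sum fun z => (p ξ _ z : ℝ≥0∞) • Measure.dirac z)
        ((fun y : V => IicProdIoc (X := fun _ => V) n (n + 1)
          (h, MeasurableEquiv.piSingleton (X := fun _ => V) n y)) ⁻¹' B) = _
      rw [Measure.sum_apply _ (hf hB)]
      refine tsum_congr fun y => ?_
      rw [Measure.smul_apply, Measure.dirac_apply' _ (hf hB), smul_eq_mul]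
      rfl
    simp_rw [key2]
    exact Measurable.tsum fun y => ((hm _ _).coe_nnreal_ennreal).mul_const _

theorem measurable_walkLaw {p : Ξ → V → V → ℝ≥0} (hp : ∀ ξ x, HasSum (p ξ x) 1)
    (hm : ∀ x y, Measurable fun ξ => p ξ x y) (x : V) :
    Measurable fun ξ => walkLaw (p ξ) (hp ξ) x := by
  refine Measurable.measure_of_isPiSystem_of_isProbabilityMeasure
    (S := measurableCylinders fun _ : ℕ => V) generateFrom_measurableCylinders.symm
    isPiSystem_measurableCylinders ?_
  intro s hs
  rw [measurableCylinders_nat] at hs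
  simp only [Set.mem_iUnion, Set.mem_singleton_iff] at hs
  obtain ⟨n, B, hB, rfl⟩ := hs
  have key : ∀ ξ, walkLaw (p ξ) (hp ξ) x (cylinder (Finset.Iic n) B) =
      Kernel.partialTraj (X := fun _ => V) (pathKernel (p ξ)) 0 n (fun _ => x) B := by
    intro ξ
    have := isMarkovKernel_pathKernel (hp ξ)
    rw [← Kernel.traj_map_frestrictLe_apply, Measure.map_apply (Preorder.measurable_frestrictLe n) hB]
    rfl
  simp_rw [key]
  exact measurable_partialTraj hp hm x n B hB

theorem measurable_twoSidedLaw {p r : Ξ → V → V → ℝ≥0}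
    (hp : ∀ ξ x, HasSum (p ξ x) 1) (hpm : ∀ x y, Measurable fun ξ => p ξ x y)
    (hr : ∀ ξ x, HasSum (r ξ x) 1) (hrm : ∀ x y, Measurable fun ξ => r ξ x y) (x : V) :
    Measurable fun ξ => twoSidedLaw (p ξ) (hp ξ) (r ξ) (hr ξ) x := by
  let κ : Kernel Ξ (ℕ → V) := ⟨fun ξ => walkLaw (p ξ) (hp ξ) x, measurable_walkLaw hp hpm x⟩
  let η : Kernel Ξ (ℕ → V) := ⟨fun ξ => walkLaw (r ξ) (hr ξ) x, measurable_walkLaw hr hrm x⟩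
  have : IsMarkovKernel κ := ⟨fun ξ => inferInstanceAs (IsProbabilityMeasure (walkLaw (p ξ) (hp ξ) x))⟩
  have : IsMarkovKernel η := ⟨fun ξ => inferInstanceAs (IsProbabilityMeasure (walkLaw (r ξ) (hr ξ) x))⟩
  have h := ((κ ×ₖ η).map glue).measurable
  have e : (fun ξ => twoSidedLaw (p ξ) (hp ξ) (r ξ) (hr ξ) x) = ((κ ×ₖ η).map glue : _ → _) := by
    funext ξ
    rw [Kernel.map_apply _ measurable_glue, Kernel.prod_apply]
    rfl
  rw [e]
  exact h

end Chain

/-! ### Random environments -/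

section Environment

variable {V Ξ : Type*} [MeasurableSpace V] [MeasurableSpace Ξ]

/-- A random environment from `Ξ`: a measurable function `q : Ξ × V × V → [0, 1]` all of whose rows
`q ξ x` sum to `1` (in particular its values are at most `1`). -/
structure IsRandomEnvironment (q : Ξ → V → V → ℝ≥0) : Prop where
  measurable : Measurable fun a : Ξ × V × V => q a.1 a.2.1 a.2.2
  hasSum_one : ∀ ξ x, HasSum (q ξ x) 1

theorem IsRandomEnvironment.measurable_entry {q : Ξ → V → V → ℝ≥0} (hq : IsRandomEnvironment q)
    (x y : V) : Measurable fun ξ => q ξ x y :=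
  hq.measurable.comp (g := fun a : Ξ × V × V => q a.1 a.2.1 a.2.2)
    (f := fun ξ => (ξ, x, y)) (measurable_id.prodMk measurable_const)

/-- Invariance of an environment under the diagonal action of `Γ`. -/
def IsInvariantEnvironment (Γ : Type*) {V Ξ : Type*} [SMul Γ V] [SMul Γ Ξ]
    (q : Ξ → V → V → ℝ≥0) : Prop :=
  ∀ (γ : Γ) ξ x y, q (γ • ξ) (γ • x) (γ • y) = q ξ x y

/-- `μ` is a stationary (not necessarily finite) measure for the transition probabilities `p`. -/
def IsStationary {V : Type*} (p : V → V → ℝ≥0) (μ : V → ℝ≥0) : Prop :=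
  ∀ y, HasSum (fun x => μ x * p x y) (μ y)

open Classical in
/-- The time reversal of `q` with respect to the weights `x ↦ ν ξ x * m x`. The quotient only makes
sense at states of positive `ν`-weight; at a state with `ν ξ x = 0` the reversed walk stays put. -/
def reversal {V Ξ : Type*} (m : V → ℝ≥0) (ν : Ξ → V → ℝ≥0) (q : Ξ → V → V → ℝ≥0) :
    Ξ → V → V → ℝ≥0 := fun ξ x y =>
  if ν ξ x = 0 then (if x = y then 1 else 0)
  else (ν ξ y * m y) / (ν ξ x * m x) * q ξ y x

variable [Countable V] [MeasurableSingletonClass V]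

/-- The law `θ_ξ^x` of the two-sided walk started at `x` (forward transition probabilities `q ξ`,
backward transition probabilities `r ξ`), as a probability kernel in `ξ`. -/
def environmentLaw {q r : Ξ → V → V → ℝ≥0} (hq : IsRandomEnvironment q)
    (hr : IsRandomEnvironment r) (x : V) : Kernel Ξ (ℤ → V) where
  toFun ξ := twoSidedLaw (q ξ) (hq.hasSum_one ξ) (r ξ) (hr.hasSum_one ξ) x
  measurable' := measurable_twoSidedLaw hq.hasSum_one hq.measurable_entry hr.hasSum_one
    hr.measurable_entry x

instance {q r : Ξ → V → V → ℝ≥0} (hq : IsRandomEnvironment q) (hr : IsRandomEnvironment r) (x : V) :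
    IsMarkovKernel (environmentLaw hq hr x) :=
  ⟨fun ξ => inferInstanceAs (IsProbabilityMeasure
    (twoSidedLaw (q ξ) (hq.hasSum_one ξ) (r ξ) (hr.hasSum_one ξ) x))⟩

/-- The joint law `Θ_x` of `(ξ, ŵ)` biased by `ν ξ x`: first `ξ` is drawn from the measure with
density `ξ ↦ ν ξ x` with respect to `P`, then `ŵ` from `θ_ξ^x`. -/
def biasedLaw (P : Measure Ξ) (ν : Ξ → V → ℝ≥0) {q r : Ξ → V → V → ℝ≥0}
    (hq : IsRandomEnvironment q) (hr : IsRandomEnvironment r) (x : V) : Measure (Ξ × (ℤ → V)) :=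
  (P.withDensity fun ξ => (ν ξ x : ℝ≥0∞)).bind (Kernel.id ×ₖ environmentLaw hq hr x)

/-- `Θ = ∑ i, Θ_{o i}`. -/
def totalLaw {L : ℕ} (o : Fin L → V) (P : Measure Ξ) (ν : Ξ → V → ℝ≥0) {q r : Ξ → V → V → ℝ≥0}
    (hq : IsRandomEnvironment q) (hr : IsRandomEnvironment r) : Measure (Ξ × (ℤ → V)) :=
  ∑ i, biasedLaw P ν hq hr (o i)

end Environment

/-! ### The group action, the shift and the invariant events -/

section Action

/-- `m x`, the Haar measure of the stabilizer of `x`. -/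
def stabilizerMass {Γ V : Type*} [Group Γ] [MulAction Γ V] [MeasurableSpace Γ] (haar : Measure Γ)
    (x : V) : ℝ≥0 :=
  (haar (MulAction.stabilizer Γ x : Set Γ)).toNNReal

/-- The shift `(ξ, ŵ) ↦ (ξ, ŵ (· + 1))` on `Ξ × V^ℤ`. -/
def shift {V Ξ : Type*} (a : Ξ × (ℤ → V)) : Ξ × (ℤ → V) := (a.1, fun n => a.2 (n + 1))

/-- The σ-field of `Γ`-invariant measurable subsets of `α`. -/
abbrev invariantSigma (Γ α : Type*) [SMul Γ α] [MeasurableSpace α] : MeasurableSpace α where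
  MeasurableSet' A := MeasurableSet A ∧ ∀ γ : Γ, (fun a : α => γ • a) ⁻¹' A = A
  measurableSet_empty := ⟨MeasurableSet.empty, fun _ => rfl⟩
  measurableSet_compl A hA := ⟨hA.1.compl, fun γ => by rw [Set.preimage_compl, hA.2 γ]⟩
  measurableSet_iUnion f hf := ⟨MeasurableSet.iUnion fun i => (hf i).1, fun γ => by
    rw [Set.preimage_iUnion]; exact Set.iUnion_congr fun i => (hf i).2 γ⟩

theorem invariantSigma_le (Γ α : Type*) [SMul Γ α] [m : MeasurableSpace α] :
    invariantSigma Γ α ≤ m := fun _ hA => hA.1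

end Action

end TwoSidedWalk

end

/-! Split `shift ⁻¹' A` by the vertex at time 1 and `A` by the vertex at time -1. With F x y =
Θ_x(shift ⁻¹' A, ŵ 1 = y) and G x y = Θ_x(A, ŵ (-1) = y), the claim reads ∑ i, ∑ y, F (o i) y = ∑ i,
∑ y, G (o i) y. Both functions are diagonally invariant (`biasedLaw_smul`). Seen from the edge x →
y, the walk from x that first steps to y and the walk from y that first steps back to x have the
same law up to the factors q x y and r y x (r the reversal). The reversal is chosen so that m x * ν
x * q x y = m y * ν y * r y x (`reversal_balance`), hence m x * F x y = m y * G y x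
(`biasedLaw_shift_eq`).

`mass_transport` concludes, one orbit of pairs at a time. By a measured orbit-stabilizer theorem
(`tsum_orbit_mul_pairMass`), the orbit of (x, y) contributes m x * F x y / |Γ_x ∩ Γ_y| to the first
sum, and its flip contributes m y * G y x / |Γ_x ∩ Γ_y| to the second. The same count shows that m y
/ m x is invariant, hence so is the reversed environment. -/

namespace TwoSidedWalk

/-! ### Mass transport through Haar measures of stabilizers -/

section MassTransport

variable {Γ V : Type*} [Group Γ] [MulAction Γ V]

/-- The Haar measure of the joint stabilizer of `x` and `y`. -/
noncomputable def pairMass [MeasurableSpace Γ] (haar : Measure Γ) (x y : V) : ℝ≥0∞ :=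
  haar ((MulAction.stabilizer Γ x : Set Γ) ∩ MulAction.stabilizer Γ y)

theorem pairMass_comm [MeasurableSpace Γ] (haar : Measure Γ) (x y : V) :
    pairMass haar x y = pairMass haar y x := by
  rw [pairMass, pairMass, Set.inter_comm]

open Classical in
/-- The sum over representatives `o i` and over `y` of `F (o i) y`, restricted to the pairs whose
class is `c`. -/
noncomputable def classSum {Q : Type*} {L : ℕ} (o : Fin L → V) (φ : V → V → Q)
    (F : V → V → ℝ≥0∞) (c : Q) : ℝ≥0∞ :=
  ∑ i, ∑' y, if φ (o i) y = c then F (o i) y else 0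

theorem tsum_classSum {Q : Type*} {L : ℕ} (o : Fin L → V) (φ : V → V → Q)
    (F : V → V → ℝ≥0∞) : ∑' c, classSum o φ F c = ∑ i, ∑' y, F (o i) y := by
  simp only [classSum]
  rw [Summable.tsum_finsetSum fun _ _ => ENNReal.summable]
  refine Finset.sum_congr rfl fun i _ => ?_
  rw [ENNReal.tsum_comm]
  refine tsum_congr fun y => ?_
  simp

variable [TopologicalSpace Γ] [IsTopologicalGroup Γ] [MeasurableSpace Γ] [BorelSpace Γ]

/-- The elements of the stabilizer of `x` that move `y` to `g • y` form a left coset of the joint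
stabilizer. -/
theorem measure_stabilizer_inter_transporter (haar : Measure Γ) [haar.IsMulLeftInvariant]
    {x y : V} {g : Γ} (hg : g • x = x) :
    haar ((MulAction.stabilizer Γ x : Set Γ) ∩ {γ | γ • y = g • y}) = pairMass haar x y := by
  rw [pairMass, eq_comm, ← measure_preimage_mul haar g⁻¹]
  congr 1
  ext γ
  simp [mul_smul, inv_smul_eq_iff, hg]

theorem measurableSet_transporter {x y : V}
    (hmeas : MeasurableSet (MulAction.stabilizer Γ x : Set Γ)) :
    MeasurableSet {γ : Γ | γ • x = y} := by
  by_cases h : ∃ g : Γ, g • x = y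
  · obtain ⟨g, rfl⟩ := h
    convert measurable_const_mul g⁻¹ hmeas using 1
    ext γ
    simp [mul_smul, inv_smul_eq_iff]
  · convert MeasurableSet.empty
    ext γ
    simpa using fun e => h ⟨γ, e⟩

-- Orbit-stabilizer in measured form: the stabilizer of `x` is partitioned by the image of `y`, and
-- each nonempty piece is a left coset of the joint stabilizer.
open Classical in
theorem tsum_orbit_mul_pairMass [Countable V] (haar : Measure Γ) [haar.IsMulLeftInvariant]
    (hmeas : ∀ x : V, MeasurableSet (MulAction.stabilizer Γ x : Set Γ)) (x y : V) :
    (∑' z : V, if ∃ γ : Γ, γ • x = x ∧ γ • y = z then (1 : ℝ≥0∞) else 0) * pairMass haar x y =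
      haar (MulAction.stabilizer Γ x : Set Γ) := by
  have hU : (MulAction.stabilizer Γ x : Set Γ) =
      ⋃ z : V, (MulAction.stabilizer Γ x : Set Γ) ∩ {γ | γ • y = z} := by
    ext γ
    simp
  conv_rhs => rw [hU]
  rw [measure_iUnion, ← ENNReal.tsum_mul_right]
  · refine tsum_congr fun z => ?_
    split_ifs with h
    · obtain ⟨g, hg, rfl⟩ := h
      rw [one_mul, measure_stabilizer_inter_transporter haar hg]
    · rw [zero_mul, eq_comm]
      convert measure_empty (μ := haar)
      ext γ
      simpa using fun e₁ e₂ => h ⟨γ, e₁, e₂⟩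
  · intro z z' hz
    refine Set.disjoint_left.2 fun γ h h' => hz ?_
    exact h.2.symm.trans h'.2
  · exact fun z => (hmeas x).inter (measurableSet_transporter (hmeas y))

/-- Countably many left translates of the joint stabilizer cover `Γ`, so it cannot be null. This
permits division by `pairMass`. -/
theorem pairMass_ne_zero [Countable V] (haar : Measure Γ) [haar.IsMulLeftInvariant] [NeZero haar]
    (x y : V) : pairMass haar x y ≠ 0 := by
  intro h
  refine NeZero.ne haar (Measure.measure_univ_eq_zero.1 ?_)
  have hU : (Set.univ : Set Γ) = ⋃ z : V × V, {γ | γ • x = z.1 ∧ γ • y = z.2} := by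
    ext γ
    simp
  rw [hU]
  refine measure_iUnion_null fun z => ?_
  by_cases hz : ∃ g : Γ, g • x = z.1 ∧ g • y = z.2
  · obtain ⟨g, h₁, h₂⟩ := hz
    rw [pairMass, ← measure_preimage_mul haar g⁻¹] at h
    rw [← h]
    congr 1
    ext γ
    simp [mul_smul, inv_smul_eq_iff, h₁, h₂]
  · convert measure_empty (μ := haar)
    ext γ
    simpa using fun e₁ e₂ => hz ⟨γ, e₁, e₂⟩

/-- The ratio of the Haar measures of two stabilizers only depends on the orbit of the pair. -/
theorem measure_stabilizer_smul_mul [Countable V] (haar : Measure Γ) [haar.IsMulLeftInvariant]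
    [NeZero haar] (hmeas : ∀ x : V, MeasurableSet (MulAction.stabilizer Γ x : Set Γ))
    (hfin : ∀ x : V, haar (MulAction.stabilizer Γ x : Set Γ) < ∞) (γ : Γ) (x y : V) :
    haar (MulAction.stabilizer Γ (γ • x) : Set Γ) * haar (MulAction.stabilizer Γ y : Set Γ) =
      haar (MulAction.stabilizer Γ (γ • y) : Set Γ) * haar (MulAction.stabilizer Γ x : Set Γ) := by
  classical
  let N : V → V → ℝ≥0∞ := fun x y =>
    ∑' z : V, if ∃ γ : Γ, γ • x = x ∧ γ • y = z then (1 : ℝ≥0∞) else 0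
  have hN : ∀ x y, N x y * pairMass haar x y = haar (MulAction.stabilizer Γ x : Set Γ) :=
    tsum_orbit_mul_pairMass haar hmeas
  have hNγ : N (γ • x) (γ • y) = N x y ∧ N (γ • y) (γ • x) = N y x := by
    -- Conjugation by `γ` carries one stabilizer orbit onto the other.
    have key : ∀ x y, N (γ • x) (γ • y) = N x y := by
      intro x y
      refine ((MulAction.toPerm γ).tsum_eq _).symm.trans (tsum_congr fun z => ?_)
      refine if_congr ⟨?_, ?_⟩ rfl rfl
      · rintro ⟨g, h₁, h₂⟩
        refine ⟨γ⁻¹ * g * γ, ?_, ?_⟩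
        · simp [mul_smul, h₁]
        · simpa [mul_smul, inv_smul_eq_iff] using h₂
      · rintro ⟨g, h₁, h₂⟩
        refine ⟨γ * g * γ⁻¹, ?_, ?_⟩
        · simp [mul_smul, h₁]
        · simp [mul_smul, h₂]
    exact ⟨key x y, key y x⟩
  -- Both sides are `N x y * N y x * pairMass haar x y`; the ratio of stabilizer masses is thus a
  -- ratio of orbit sizes.
  have hbal : ∀ x y, haar (MulAction.stabilizer Γ x : Set Γ) * N y x =
      haar (MulAction.stabilizer Γ y : Set Γ) * N x y := fun x y => by
    rw [← hN x y, ← hN y x, pairMass_comm haar y x]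
    ring
  have hfin' : N x y ≠ ∞ := fun h => (hfin x).ne <| by
    rw [← hN x y, h, ENNReal.top_mul (pairMass_ne_zero haar x y)]
  have hpos : N x y ≠ 0 := fun h => pairMass_ne_zero haar x y <| by
    refine measure_mono_null Set.inter_subset_left ?_
    rw [← hN x y, h, zero_mul]
  refine (ENNReal.mul_left_inj hpos hfin').1 ?_
  have h₁ := hbal (γ • x) (γ • y)
  rw [hNγ.1, hNγ.2] at h₁
  rw [mul_assoc, ← hbal x y, mul_left_comm, h₁]
  ring

/-- The class sum can be computed from any base point `x` in the orbit of its representative. There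
it is `F x y` times the size of the orbit of `y` under the stabilizer of `x`. -/
theorem classSum_mul_pairMass [Countable V] (haar : Measure Γ) [haar.IsMulLeftInvariant]
    (hmeas : ∀ x : V, MeasurableSet (MulAction.stabilizer Γ x : Set Γ))
    {L : ℕ} {o : Fin L → V} (ho : ∀ x : V, ∃! i, x ∈ MulAction.orbit Γ (o i))
    {Q : Type*} {φ : V → V → Q}
    (hφ : ∀ x y x' y', φ x y = φ x' y' ↔ ∃ γ : Γ, γ • x = x' ∧ γ • y = y')
    {F : V → V → ℝ≥0∞} (hF : ∀ (γ : Γ) x y, F (γ • x) (γ • y) = F x y) (x y : V) :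
    classSum o φ F (φ x y) * pairMass haar x y =
      haar (MulAction.stabilizer Γ x : Set Γ) * F x y := by
  classical
  obtain ⟨i, ⟨g, hg⟩, hi⟩ := ho x
  simp only at hg
  have hφg : ∀ (γ : Γ) a b, φ (γ • a) (γ • b) = φ a b := fun γ a b =>
    ((hφ a b _ _).2 ⟨γ, rfl, rfl⟩).symm
  have h₁ : classSum o φ F (φ x y) = ∑' z, if φ (o i) z = φ x y then F (o i) z else 0 := by
    rw [classSum, Finset.sum_eq_single i]
    · intro j _ hj
      refine ENNReal.tsum_eq_zero.2 fun z => if_neg fun e => hj (hi j ?_)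
      obtain ⟨γ, h, -⟩ := (hφ _ _ _ _).1 e
      exact ⟨γ, h⟩
    · simp
  have h₂ : classSum o φ F (φ x y) = ∑' z, if φ x z = φ x y then F x z else 0 := by
    rw [h₁, ← (MulAction.toPerm g).tsum_eq fun z => if φ x z = φ x y then F x z else 0]
    refine tsum_congr fun z => ?_
    rw [MulAction.toPerm_apply]
    have e₁ : φ x (g • z) = φ (o i) z := by rw [← hg, hφg]
    have e₂ : F x (g • z) = F (o i) z := by rw [← hg, hF]
    simp only [e₁, e₂]
  have h₃ : classSum o φ F (φ x y) =
      (∑' z : V, if ∃ γ : Γ, γ • x = x ∧ γ • y = z then (1 : ℝ≥0∞) else 0) * F x y := by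
    rw [h₂, ← ENNReal.tsum_mul_right]
    refine tsum_congr fun z => ?_
    rw [eq_comm, eq_comm (a := φ x z), ite_mul, one_mul, zero_mul]
    refine if_ctx_congr (hφ x y x z).symm (fun h => ?_) fun _ => rfl
    obtain ⟨γ, e₁, e₂⟩ := (hφ x y x z).1 h
    nth_rewrite 2 [← e₁]
    rw [← e₂, hF]
  rw [h₃, mul_right_comm, tsum_orbit_mul_pairMass haar hmeas]

/-- The mass transport principle for a quasi-transitive action, in terms of the Haar measures of the
stabilizers. -/
theorem mass_transport [Countable V] (haar : Measure Γ) [haar.IsMulLeftInvariant] [NeZero haar]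
    (hmeas : ∀ x : V, MeasurableSet (MulAction.stabilizer Γ x : Set Γ))
    (hfin : ∀ x : V, haar (MulAction.stabilizer Γ x : Set Γ) < ∞)
    {L : ℕ} {o : Fin L → V} (ho : ∀ x : V, ∃! i, x ∈ MulAction.orbit Γ (o i))
    {F G : V → V → ℝ≥0∞} (hF : ∀ (γ : Γ) x y, F (γ • x) (γ • y) = F x y)
    (hG : ∀ (γ : Γ) x y, G (γ • x) (γ • y) = G x y)
    (hFG : ∀ x y, haar (MulAction.stabilizer Γ x : Set Γ) * F x y =
      haar (MulAction.stabilizer Γ y : Set Γ) * G y x) :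
    ∑ i, ∑' y, F (o i) y = ∑ i, ∑' y, G (o i) y := by
  -- Classes are the diagonal orbits of pairs; for `G` the pair is flipped, so that one class
  -- matches `F x y` with `G y x`.
  let φ : V → V → MulAction.orbitRel.Quotient Γ (V × V) := fun x y => Quotient.mk'' (x, y)
  have hφ : ∀ x y x' y', φ x y = φ x' y' ↔ ∃ γ : Γ, γ • x = x' ∧ γ • y = y' := by
    intro x y x' y'
    rw [eq_comm]
    refine Quotient.eq''.trans ?_
    rw [MulAction.orbitRel_apply, MulAction.mem_orbit_iff]
    simp [Prod.ext_iff]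
  have hψ : ∀ x y x' y', φ y x = φ y' x' ↔ ∃ γ : Γ, γ • x = x' ∧ γ • y = y' := fun x y x' y' => by
    simp only [hφ, and_comm]
  rw [← tsum_classSum o φ F, ← tsum_classSum o (fun x y => φ y x) G]
  refine tsum_congr fun c => ?_
  induction c using Quotient.inductionOn' with | _ p => ?_
  obtain ⟨x, y⟩ := p
  refine (ENNReal.mul_left_inj (pairMass_ne_zero haar x y)
    ((measure_mono Set.inter_subset_left).trans_lt (hfin x)).ne).1 ?_
  refine (classSum_mul_pairMass haar hmeas ho hφ hF x y).trans ?_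
  rw [pairMass_comm, hFG]
  exact (classSum_mul_pairMass haar hmeas ho (φ := fun x y => φ y x) hψ hG y x).symm

end MassTransport

/-! ### Prepending a vertex, and cylinder events -/

section Cons

variable {V : Type*}

/-- The path that starts at `x` and then follows `w`. -/
def consPath (x : V) (w : ℕ → V) : ℕ → V
  | 0 => x
  | n + 1 => w n

theorem measurable_consPath [MeasurableSpace V] (x : V) : Measurable (consPath x) := by
  refine measurable_pi_lambda _ fun k => ?_
  cases k with
  | zero => exact measurable_const
  | succ n => exact measurable_pi_apply n

theorem measurableSet_eval_eq {ι : Type*} [MeasurableSpace V] [MeasurableSingletonClass V] (i : ι)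
    (x : V) : MeasurableSet {w : ι → V | w i = x} := by
  have h := measurable_pi_apply (X := fun _ : ι => V) i (measurableSet_singleton x)
  exact h

theorem measurableSet_path_cylinder [MeasurableSpace V] [MeasurableSingletonClass V] (n : ℕ) (a : ℕ → V) :
    MeasurableSet {w : ℕ → V | ∀ k ≤ n, w k = a k} := by
  simp only [Set.ofPred_forall]
  exact MeasurableSet.iInter fun k => MeasurableSet.iInter fun _ => measurableSet_eval_eq k _

end Cons

/-! ### The one-sided walk: cylinder probabilities, equivariance, first step -/

section Walk

variable {V : Type*} [Countable V] [MeasurableSpace V] [MeasurableSingletonClass V]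

/-- Finite measures on path space that agree on the cylinders fixing the path up to a positive time
are equal. -/
theorem ext_of_path_cylinder {μ μ' : Measure (ℕ → V)} [IsFiniteMeasure μ] [IsFiniteMeasure μ']
    (h : ∀ (n : ℕ) (a : ℕ → V),
      μ {w | ∀ k ≤ n + 1, w k = a k} = μ' {w | ∀ k ≤ n + 1, w k = a k}) : μ = μ' := by
  rcases isEmpty_or_nonempty V with hV | ⟨⟨v⟩⟩
  · exact Subsingleton.elim _ _
  have hmap : ∀ n : ℕ, μ.map (Preorder.frestrictLe (π := fun _ : ℕ => V) (n + 1)) =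
      μ'.map (Preorder.frestrictLe (π := fun _ : ℕ => V) (n + 1)) := by
    intro n
    refine Measure.ext_iff_singleton.2 fun b => ?_
    rw [Measure.map_apply (Preorder.measurable_frestrictLe _) (measurableSet_singleton _),
      Measure.map_apply (Preorder.measurable_frestrictLe _) (measurableSet_singleton _)]
    -- The value `v` after time `n + 1` is mere padding.
    convert h n (fun k => if hk : k ≤ n + 1 then b ⟨k, Finset.mem_Iic.2 hk⟩ else v) using 2 <;>
    · ext w
      simp only [Set.mem_preimage, Set.mem_singleton_iff, funext_iff, Subtype.forall,
        Finset.mem_Iic, Preorder.frestrictLe_apply]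
      refine forall₂_congr fun k hk => ?_
      simp [hk]
  have hcyl : ∀ s ∈ measurableCylinders fun _ : ℕ => V, μ s = μ' s := by
    intro s hs
    obtain ⟨I, S, hS, rfl⟩ := (mem_measurableCylinders _).1 hs
    have hI : I ⊆ Finset.Iic (I.sup id + 1) := fun i hi =>
      Finset.mem_Iic.2 ((Finset.le_sup (f := id) hi).trans (Nat.le_succ _))
    have hS' : MeasurableSet (Finset.restrict₂ (π := fun _ : ℕ => V) hI ⁻¹' S) :=
      Finset.measurable_restrict₂ _ hS
    have e := congrArg (fun m => m (Finset.restrict₂ (π := fun _ : ℕ => V) hI ⁻¹' S))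
      (hmap (I.sup id))
    rwa [Measure.map_apply (Preorder.measurable_frestrictLe _) hS',
      Measure.map_apply (Preorder.measurable_frestrictLe _) hS'] at e
  refine ext_of_generate_finite _ generateFrom_measurableCylinders.symm
    isPiSystem_measurableCylinders hcyl (hcyl _ ?_)
  exact univ_mem_measurableCylinders _

-- The kernel appends one vertex to the history, so reaching the longer truncation of `a` forces the
-- history to be the shorter one and costs a single transition.
open Classical in
theorem partialTraj_succ_singleton {p : V → V → ℝ≥0} (hp : ∀ x, HasSum (p x) 1) (n : ℕ)
    (h : Finset.Iic n → V) (a : ℕ → V) :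
    Kernel.partialTraj (X := fun _ => V) (pathKernel p) n (n + 1) h
        {Preorder.frestrictLe (π := fun _ => V) (n + 1) a} =
      if h = Preorder.frestrictLe (π := fun _ => V) n a then (p (a n) (a (n + 1)) : ℝ≥0∞) else 0 := by
  have := isMarkovKernel_pathKernel hp
  have hB := measurableSet_singleton (Preorder.frestrictLe (π := fun _ => V) (n + 1) a)
  have hB' := measurable_IicProdIoc (X := fun _ : ℕ => V) (m := n) (n := n + 1) hB
  rw [Kernel.partialTraj_succ_self]
  erw [Kernel.map_apply' _ measurable_IicProdIoc _ hB, Kernel.id_prod_apply' _ _ hB',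
    Kernel.map_apply' _ (MeasurableEquiv.measurable _) _ (measurable_prodMk_left hB')]
  change chainKernel p (h ⟨n, Finset.mem_Iic.2 le_rfl⟩)
    {y | IicProdIoc (X := fun _ => V) n (n + 1)
      (h, MeasurableEquiv.piSingleton (X := fun _ => V) n y) =
        Preorder.frestrictLe (π := fun _ => V) (n + 1) a} = _
  have key : ∀ y, IicProdIoc (X := fun _ => V) n (n + 1)
      (h, MeasurableEquiv.piSingleton (X := fun _ => V) n y) =
        Preorder.frestrictLe (π := fun _ => V) (n + 1) a ↔
      h = Preorder.frestrictLe (π := fun _ => V) n a ∧ y = a (n + 1) := by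
    intro y
    simp only [funext_iff, Subtype.forall, Finset.mem_Iic, Preorder.frestrictLe_apply]
    constructor
    · intro H
      refine ⟨fun k hk => ?_, ?_⟩
      · simpa [IicProdIoc, hk] using H k (hk.trans n.le_succ)
      · have := H (n + 1) le_rfl
        simpa [IicProdIoc, MeasurableEquiv.piSingleton] using this
    · rintro ⟨H, rfl⟩ k hk
      by_cases hkn : k ≤ n
      · simpa [IicProdIoc, hkn] using H k hkn
      · obtain rfl : k = n + 1 := by omega
        simp [IicProdIoc, MeasurableEquiv.piSingleton]
  simp only [key]
  split_ifs with hh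
  · subst hh
    simp only [true_and, Set.ofPred_eq_eq_singleton]
    exact chainKernel_singleton p _ _
  · simp [hh]

open Classical in
/-- The finite-dimensional distributions of the Markov chain. -/
theorem walkLaw_cylinder {p : V → V → ℝ≥0} (hp : ∀ x, HasSum (p x) 1) (x : V) (n : ℕ)
    (a : ℕ → V) :
    walkLaw p hp x {w | ∀ k ≤ n, w k = a k} =
      (if a 0 = x then 1 else 0) * ∏ k ∈ Finset.range n, (p (a k) (a (k + 1)) : ℝ≥0∞) := by
  have := isMarkovKernel_pathKernel hp
  have e : {w : ℕ → V | ∀ k ≤ n, w k = a k} =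
      Preorder.frestrictLe (π := fun _ => V) n ⁻¹' {Preorder.frestrictLe (π := fun _ => V) n a} := by
    ext w
    simp [funext_iff]
  rw [e, walkLaw, ← Measure.map_apply (Preorder.measurable_frestrictLe n)
    (measurableSet_singleton _)]
  erw [Kernel.traj_map_frestrictLe_apply]
  clear e
  induction n with
  | zero =>
    rw [Kernel.partialTraj_self, Kernel.id_apply, Measure.dirac_apply' _ (measurableSet_singleton _)]
    simp only [Set.indicator_apply, Set.mem_singleton_iff, Finset.range_zero, Finset.prod_empty,
      mul_one, Pi.one_apply]
    refine if_congr ?_ rfl rfl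
    simp [funext_iff, eq_comm]
  | succ n ih =>
    rw [Kernel.partialTraj_succ_eq_comp (Nat.zero_le n)]
    erw [Kernel.comp_apply' _ _ _ (measurableSet_singleton _), lintegral_countable']
    rw [tsum_eq_single (Preorder.frestrictLe (π := fun _ => V) n a), partialTraj_succ_singleton hp,
      if_pos rfl, ih, Finset.prod_range_succ]
    · ring
    · intro h hh
      rw [partialTraj_succ_singleton hp, if_neg hh, zero_mul]

theorem walkLaw_start {p : V → V → ℝ≥0} (hp : ∀ x, HasSum (p x) 1) (x : V) :
    ∀ᵐ w ∂walkLaw p hp x, w 0 = x := by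
  have h := walkLaw_cylinder hp x 0 fun _ => x
  simp only [nonpos_iff_eq_zero, forall_eq, if_true, Finset.range_zero, Finset.prod_empty,
    mul_one] at h
  exact (prob_compl_eq_zero_iff (measurableSet_eval_eq 0 x)).2 h

/-- The walk law is equivariant under bijections that intertwine the transition probabilities. -/
theorem walkLaw_map_equiv {p p' : V → V → ℝ≥0} (hp : ∀ x, HasSum (p x) 1)
    (hp' : ∀ x, HasSum (p' x) 1) (g : V ≃ V) (h : ∀ a b, p' (g a) (g b) = p a b) (x : V) :
    (walkLaw p hp x).map (fun w k => g (w k)) = walkLaw p' hp' (g x) := by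
  have hg : Measurable fun (w : ℕ → V) k => g (w k) :=
    measurable_pi_lambda _ fun k => (measurable_of_countable g).comp (measurable_pi_apply k)
  have := Measure.isProbabilityMeasure_map (μ := walkLaw p hp x) hg.aemeasurable
  refine ext_of_path_cylinder fun n a => ?_
  rw [Measure.map_apply hg (measurableSet_path_cylinder _ _), walkLaw_cylinder]
  have e : (fun (w : ℕ → V) k => g (w k)) ⁻¹' {w | ∀ k ≤ n + 1, w k = a k} =
      {w | ∀ k ≤ n + 1, w k = g.symm (a k)} := by
    ext w
    simp only [Set.mem_preimage, Set.mem_ofPred_eq, Equiv.eq_symm_apply]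
  rw [e, walkLaw_cylinder]
  congr 1
  · by_cases ha : a 0 = g x
    · rw [if_pos ha, if_pos (g.symm_apply_eq.2 ha)]
    · rw [if_neg ha, if_neg (mt g.symm_apply_eq.1 ha)]
  · refine Finset.prod_congr rfl fun k _ => ?_
    rw [← h, g.apply_symm_apply, g.apply_symm_apply]

/-- The Markov property at the first step. -/
theorem walkLaw_restrict_step {p : V → V → ℝ≥0} (hp : ∀ x, HasSum (p x) 1) (x y : V) :
    (walkLaw p hp x).restrict {w | w 1 = y} =
      p x y • (walkLaw p hp y).map (consPath x) := by
  classical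
  have := Measure.isProbabilityMeasure_map (μ := walkLaw p hp y) (measurable_consPath x).aemeasurable
  refine ext_of_path_cylinder fun n a => ?_
  rw [Measure.restrict_apply (measurableSet_path_cylinder _ _), Measure.smul_apply,
    Measure.map_apply (measurable_consPath x) (measurableSet_path_cylinder _ _)]
  -- The bound `n + 1` ensures that the cylinder prescribes time 1, so the event `w 1 = y` either
  -- contains it or misses it.
  have e₁ : {w : ℕ → V | ∀ k ≤ n + 1, w k = a k} ∩ {w | w 1 = y} =
      if a 1 = y then {w : ℕ → V | ∀ k ≤ n + 1, w k = a k} else ∅ := by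
    split_ifs with h
    · subst h
      exact Set.inter_eq_left.2 fun w hw => hw 1 (by omega)
    · ext w
      simp only [Set.mem_inter_iff, Set.mem_ofPred_eq, Set.mem_empty_iff_false, iff_false, not_and]
      exact fun hw e => h (by rw [← e, hw 1 (by omega)])
  have e₂ : consPath x ⁻¹' {w : ℕ → V | ∀ k ≤ n + 1, w k = a k} =
      if a 0 = x then {w : ℕ → V | ∀ k ≤ n, w k = a (k + 1)} else ∅ := by
    split_ifs with h
    · subst h
      ext w
      simp only [Set.mem_preimage, Set.mem_ofPred_eq]
      refine ⟨fun H k hk => H (k + 1) (by omega), fun H k hk => ?_⟩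
      cases k with
      | zero => rfl
      | succ k => exact H k (by omega)
    · ext w
      simp only [Set.mem_preimage, Set.mem_ofPred_eq, Set.mem_empty_iff_false, iff_false]
      exact fun H => h (H 0 (by omega)).symm
  rw [e₁, e₂]
  by_cases h₀ : a 0 = x
  · rw [if_pos h₀, walkLaw_cylinder hp y n fun k => a (k + 1)]
    by_cases h₁ : a 1 = y
    · rw [if_pos h₁, walkLaw_cylinder, Finset.prod_range_succ']
      simp [h₀, h₁, mul_comm, ENNReal.smul_def]
    · simp [h₁]
  · rw [if_neg h₀]
    by_cases h₁ : a 1 = y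
    · rw [if_pos h₁, walkLaw_cylinder]
      simp [h₀]
    · simp [h₁]

end Walk

/-! ### The two-sided walk seen from an edge -/

section TwoSided

variable {V : Type*}

/-- Only time -1 needs `hu`: there the left side shows the prepended `x`, the right side the start
of the backward path. -/
theorem glue_consPath_shift (x y : V) {u : (ℕ → V) × (ℕ → V)} (hu : u.2 0 = x) :
    (fun n : ℤ => glue (consPath x u.1, u.2) (n + 1)) = glue (u.1, consPath y u.2) := by
  funext n
  match n with
  | Int.ofNat n => rfl
  | Int.negSucc 0 => exact hu.symm
  | Int.negSucc (n + 1) => rfl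

theorem glue_equiv (g : V → V) (u : (ℕ → V) × (ℕ → V)) :
    glue (fun k => g (u.1 k), fun k => g (u.2 k)) = fun n => g (glue u n) := by
  funext n
  cases n <;> rfl

variable [Countable V] [MeasurableSpace V] [MeasurableSingletonClass V]
  {p r : V → V → ℝ≥0} (hp : ∀ x, HasSum (p x) 1) (hr : ∀ x, HasSum (r x) 1)

/-- The law of the two-sided walk seen from the edge crossed by its first step `x → y`. -/
noncomputable def edgeLaw (x y : V) : Measure (ℤ → V) :=
  ((walkLaw p hp y).prod (walkLaw r hr x)).map fun u => glue (u.1, consPath y u.2)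

/-- Markov property for the forward half: after the step to `y` it restarts from `y`, independently
of the backward half from `x`, and the shift puts `y` at the origin. -/
theorem twoSidedLaw_restrict_forward (x y : V) :
    ((twoSidedLaw p hp r hr x).restrict {w | w 1 = y}).map (fun w n => w (n + 1)) =
      (p x y : ℝ≥0∞) • edgeLaw hp hr x y := by
  have hs : MeasurableSet {w : ℤ → V | w 1 = y} :=
    measurableSet_eval_eq 1 y
  have hsh : Measurable fun (w : ℤ → V) n => w (n + 1) :=
    measurable_pi_lambda _ fun n => measurable_pi_apply (n + 1)
  have e : (glue : (ℕ → V) × (ℕ → V) → ℤ → V) ⁻¹' {w | w 1 = y} =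
      {w : ℕ → V | w 1 = y} ×ˢ Set.univ := by
    ext u
    exact (and_iff_left trivial).symm
  have hc := measurable_consPath x
  rw [twoSidedLaw, Measure.restrict_map measurable_glue hs, e, ← Measure.prod_restrict,
    Measure.restrict_univ, walkLaw_restrict_step, ENNReal.smul_def, Measure.prod_smul_left,
    Measure.map_smul, Measure.map_smul, Measure.map_map hsh measurable_glue]
  congr 1
  nth_rewrite 1 [← Measure.map_id (μ := walkLaw r hr x)]
  rw [Measure.map_prod_map _ _ hc measurable_id,
    Measure.map_map (hsh.comp measurable_glue) (hc.prodMap measurable_id), edgeLaw]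
  refine Measure.map_congr ?_
  filter_upwards [Measure.quasiMeasurePreserving_snd.ae (walkLaw_start hr x)] with u hu
  exact glue_consPath_shift x y hu

/-- The mirror image, for the backward half; `y` is already at the origin, so no shift occurs. -/
theorem twoSidedLaw_restrict_backward (x y : V) :
    (twoSidedLaw p hp r hr y).restrict {w | w (-1) = x} =
      (r y x : ℝ≥0∞) • edgeLaw hp hr x y := by
  have hs : MeasurableSet {w : ℤ → V | w (-1) = x} :=
    measurableSet_eval_eq (-1) x
  have e : (glue : (ℕ → V) × (ℕ → V) → ℤ → V) ⁻¹' {w | w (-1) = x} =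
      Set.univ ×ˢ {w : ℕ → V | w 1 = x} := by
    ext u
    exact (and_iff_right trivial).symm
  have hc := measurable_consPath y
  rw [twoSidedLaw, Measure.restrict_map measurable_glue hs, e, ← Measure.prod_restrict,
    Measure.restrict_univ, walkLaw_restrict_step, ENNReal.smul_def, Measure.prod_smul_right,
    Measure.map_smul]
  congr 1
  nth_rewrite 1 [← Measure.map_id (μ := walkLaw p hp y)]
  rw [Measure.map_prod_map _ _ measurable_id hc,
    Measure.map_map measurable_glue (measurable_id.prodMap hc), edgeLaw]
  rfl

theorem twoSidedLaw_map_equiv {p' r' : V → V → ℝ≥0} (hp' : ∀ x, HasSum (p' x) 1)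
    (hr' : ∀ x, HasSum (r' x) 1) (g : V ≃ V) (hpg : ∀ a b, p' (g a) (g b) = p a b)
    (hrg : ∀ a b, r' (g a) (g b) = r a b) (x : V) :
    (twoSidedLaw p hp r hr x).map (fun w n => g (w n)) = twoSidedLaw p' hp' r' hr' (g x) := by
  have hg : ∀ ι : Type, Measurable fun (w : ι → V) k => g (w k) := fun ι =>
    measurable_pi_lambda _ fun k => (measurable_of_countable g).comp (measurable_pi_apply k)
  rw [twoSidedLaw, twoSidedLaw, ← walkLaw_map_equiv hp hp' g hpg, ← walkLaw_map_equiv hr hr' g hrg,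
    Measure.map_prod_map _ _ (hg ℕ) (hg ℕ), Measure.map_map (hg ℤ) measurable_glue,
    Measure.map_map measurable_glue ((hg ℕ).prodMap (hg ℕ))]
  congr 1
  funext u
  exact (glue_equiv g u).symm

end TwoSided

theorem tsum_measure_inter_preimage_singleton {α V : Type*} [MeasurableSpace α] [Countable V]
    [MeasurableSpace V] [MeasurableSingletonClass V] (μ : Measure α) {f : α → V}
    (hf : Measurable f) {S : Set α} (hS : MeasurableSet S) :
    ∑' y, μ (S ∩ {a | f a = y}) = μ S := by
  rw [← measure_iUnion]
  · congr 1
    ext a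
    simp
  · intro y z hyz
    exact Set.disjoint_left.2 fun a h h' => hyz (h.2.symm.trans h'.2)
  · exact fun y => hS.inter (hf (measurableSet_singleton y))

theorem measurable_shift {V Ξ : Type*} [MeasurableSpace V] [MeasurableSpace Ξ] :
    Measurable (shift : Ξ × (ℤ → V) → Ξ × (ℤ → V)) :=
  measurable_fst.prodMk (measurable_pi_lambda _ fun n =>
    (measurable_pi_apply (n + 1)).comp measurable_snd)

/-! ### The biased law: invariance and balance across an edge -/

section BiasedLaw

variable {V Ξ : Type*} [MeasurableSpace V] [MeasurableSpace Ξ] [Countable V]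
  [MeasurableSingletonClass V] {P : Measure Ξ} {ν : Ξ → V → ℝ≥0} {q r : Ξ → V → V → ℝ≥0}
  (hq : IsRandomEnvironment q) (hr : IsRandomEnvironment r)

theorem biasedLaw_apply (hν : Measurable fun a : Ξ × V => ν a.1 a.2) (x : V)
    {S : Set (Ξ × (ℤ → V))} (hS : MeasurableSet S) :
    biasedLaw P ν hq hr x S = ∫⁻ ξ, (ν ξ x : ℝ≥0∞) *
      twoSidedLaw (q ξ) (hq.hasSum_one ξ) (r ξ) (hr.hasSum_one ξ) x (Prod.mk ξ ⁻¹' S) ∂P := by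
  have hνx : Measurable fun ξ => (ν ξ x : ℝ≥0∞) :=
    (hν.comp (measurable_id.prodMk measurable_const)).coe_nnreal_ennreal
  rw [biasedLaw, Measure.bind_apply hS (Kernel.aemeasurable _),
    lintegral_withDensity_eq_lintegral_mul _ hνx (Kernel.measurable_coe _ hS)]
  refine lintegral_congr fun ξ => ?_
  rw [Pi.mul_apply, Kernel.id_prod_apply' _ _ hS]
  rfl

/-- Substitute `γ • ξ` for `ξ`, which preserves `P`; the weight is unchanged and the walk law is
carried along by `γ`. -/
theorem biasedLaw_smul {Γ : Type*} [Group Γ] [MulAction Γ V] [MulAction Γ Ξ]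
    [MeasurableConstSMul Γ Ξ] [SMulInvariantMeasure Γ Ξ P]
    (hν : Measurable fun a : Ξ × V => ν a.1 a.2)
    (hνΓ : ∀ (γ : Γ) ξ x, ν (γ • ξ) (γ • x) = ν ξ x)
    (hqΓ : IsInvariantEnvironment Γ q) (hrΓ : IsInvariantEnvironment Γ r) (γ : Γ) (x : V)
    {S : Set (Ξ × (ℤ → V))} (hS : MeasurableSet S) :
    biasedLaw P ν hq hr (γ • x) S = biasedLaw P ν hq hr x ((fun a => γ • a) ⁻¹' S) := by
  have hg : Measurable fun (w : ℤ → V) n => γ • w n :=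
    measurable_pi_lambda _ fun k =>
      (measurable_of_countable fun v : V => γ • v).comp (measurable_pi_apply k)
  have hγ : Measurable fun a : Ξ × (ℤ → V) => γ • a :=
    ((measurable_const_smul γ).comp measurable_fst).prodMk (hg.comp measurable_snd)
  rw [biasedLaw_apply hq hr hν _ hS, biasedLaw_apply hq hr hν _ (hγ hS),
    ← (measurePreserving_smul γ P).lintegral_comp_emb (measurableEmbedding_const_smul γ)]
  refine lintegral_congr fun ξ => ?_
  rw [hνΓ, ← MulAction.toPerm_apply γ x, ← twoSidedLaw_map_equiv (hq.hasSum_one ξ)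
    (hr.hasSum_one ξ) (hq.hasSum_one (γ • ξ)) (hr.hasSum_one (γ • ξ)) (MulAction.toPerm γ)
    (hqΓ γ ξ) (hrΓ γ ξ)]
  congr 1
  exact Measure.map_apply hg (measurable_prodMk_left hS)

/-- If the backward transition probabilities `r` are the time reversal of `q` with respect to the
weights `ν ξ x * m x`, then following the first step of the walk backwards reverses the roles of its
endpoints. -/
theorem biasedLaw_shift_eq (hν : Measurable fun a : Ξ × V => ν a.1 a.2) {m : V → ℝ≥0}
    (hbal : ∀ ξ x y, m x * ν ξ x * q ξ x y = m y * ν ξ y * r ξ y x) (x y : V)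
    {A : Set (Ξ × (ℤ → V))} (hA : MeasurableSet A) :
    m x * biasedLaw P ν hq hr x (shift ⁻¹' A ∩ {a | a.2 1 = y}) =
      m y * biasedLaw P ν hq hr y (A ∩ {a | a.2 (-1) = x}) := by
  have hs : ∀ (n : ℤ) (z : V), MeasurableSet {a : Ξ × (ℤ → V) | a.2 n = z} := fun n z =>
    measurable_snd (measurableSet_eval_eq n z)
  have hsh : Measurable fun (w : ℤ → V) n => w (n + 1) :=
    measurable_pi_lambda _ fun n => measurable_pi_apply (n + 1)
  rw [biasedLaw_apply hq hr hν _ ((measurable_shift hA).inter (hs _ _)),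
    biasedLaw_apply hq hr hν _ (hA.inter (hs _ _)), ← lintegral_const_mul' _ _ ENNReal.coe_ne_top,
    ← lintegral_const_mul' _ _ ENNReal.coe_ne_top]
  refine lintegral_congr fun ξ => ?_
  have hAξ : MeasurableSet (Prod.mk ξ ⁻¹' A) := measurable_prodMk_left hA
  have h₁ := congrArg (fun μ => μ (Prod.mk ξ ⁻¹' A))
    (twoSidedLaw_restrict_forward (hq.hasSum_one ξ) (hr.hasSum_one ξ) x y)
  have h₂ := congrArg (fun μ => μ (Prod.mk ξ ⁻¹' A))
    (twoSidedLaw_restrict_backward (hq.hasSum_one ξ) (hr.hasSum_one ξ) x y)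
  simp only [Measure.map_apply hsh hAξ, Measure.restrict_apply (hsh hAξ),
    Measure.restrict_apply hAξ, Measure.smul_apply, smul_eq_mul] at h₁ h₂
  have h₃ := congrArg ((↑) : ℝ≥0 → ℝ≥0∞) (hbal ξ x y)
  push_cast at h₃
  -- Both sides are now multiples of the same `edgeLaw`, with coefficients equated by `hbal`.
  refine (congrArg (fun t => (m x : ℝ≥0∞) * (ν ξ x * t)) h₁).trans <| Eq.trans ?_
    (congrArg (fun t => (m y : ℝ≥0∞) * (ν ξ y * t)) h₂).symm
  simp only [← mul_assoc, h₃]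

end BiasedLaw

/-! ### The time-reversed environment -/

section Reversal

variable {V Ξ : Type*} {m : V → ℝ≥0} {ν : Ξ → V → ℝ≥0} {q : Ξ → V → V → ℝ≥0}

/-- If `ν ξ y = 0`, stationarity at `y` makes a sum of nonnegative terms vanish, so the left side is
zero too. Otherwise this is the defining quotient. -/
theorem reversal_balance (hm : ∀ x, m x ≠ 0)
    (hstat : ∀ ξ, IsStationary (q ξ) fun x => m x * ν ξ x) (ξ : Ξ) (x y : V) :
    m x * ν ξ x * q ξ x y = m y * ν ξ y * reversal m ν q ξ y x := by
  rw [reversal]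
  by_cases h : ν ξ y = 0
  · have hs := hstat ξ y
    simp only [h, mul_zero] at hs
    rw [h, mul_zero, zero_mul]
    exact congrFun ((hasSum_zero_iff_of_nonneg fun _ => zero_le).1 hs) x
  · rw [if_neg h]
    have := hm y
    field_simp

theorem isRandomEnvironment_reversal [MeasurableSpace V] [MeasurableSpace Ξ] [Countable V]
    [MeasurableSingletonClass V] (hm : ∀ x, m x ≠ 0) (hq : IsRandomEnvironment q)
    (hν : Measurable fun a : Ξ × V => ν a.1 a.2)
    (hstat : ∀ ξ, IsStationary (q ξ) fun x => m x * ν ξ x) :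
    IsRandomEnvironment (reversal m ν q) := by
  classical
  refine ⟨?_, fun ξ x => ?_⟩
  · refine measurable_from_prod_countable_left fun a => ?_
    have hνx : ∀ x, Measurable fun ξ => ν ξ x := fun x =>
      hν.comp (measurable_id.prodMk measurable_const)
    simp only [reversal]
    exact Measurable.ite (hνx a.1 (measurableSet_singleton 0))
      (measurable_const' fun _ _ => rfl)
      ((((hνx _).mul_const _).div ((hνx _).mul_const _)).mul (hq.measurable_entry _ _))
  · by_cases h : ν ξ x = 0
    · have e : reversal m ν q ξ x = fun y => if y = x then 1 else 0 := by
        funext y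
        rw [reversal, if_pos h]
        exact if_congr eq_comm rfl rfl
      rw [e]
      exact hasSum_ite_eq x 1
    · have h' : m x * ν ξ x ≠ 0 := mul_ne_zero (hm x) h
      -- The row sum of the reversal is stationarity at `x`, normalized.
      have hs := (hstat ξ x).mul_left (m x * ν ξ x)⁻¹
      rw [inv_mul_cancel₀ h'] at hs
      refine (congrArg (fun f => HasSum f 1) (funext fun y => ?_)).mp hs
      simp only [reversal_balance hm hstat ξ y x, inv_mul_cancel_left₀ h']

/-- Only ratios of `m` enter the reversal, so `m` itself need not be invariant; stabilizer masses
are not when `Γ` acts with nontrivial modular factors. -/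
theorem isInvariantEnvironment_reversal {Γ : Type*} [Group Γ] [MulAction Γ V] [MulAction Γ Ξ]
    (hm : ∀ (γ : Γ) x y, m (γ • y) / m (γ • x) = m y / m x) (hqΓ : IsInvariantEnvironment Γ q)
    (hνΓ : ∀ (γ : Γ) ξ x, ν (γ • ξ) (γ • x) = ν ξ x) :
    IsInvariantEnvironment Γ (reversal m ν q) := by
  classical
  intro γ ξ x y
  simp only [reversal, hνΓ, mul_div_mul_comm, hm, hqΓ γ ξ y x]
  congr 1
  exact if_congr (smul_left_cancel_iff γ) rfl rfl

end Reversal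

theorem coe_stabilizerMass {Γ V : Type*} [Group Γ] [MulAction Γ V] [MeasurableSpace Γ]
    {haar : Measure Γ} (hfin : ∀ x : V, haar (MulAction.stabilizer Γ x : Set Γ) < ∞) (x : V) :
    (stabilizerMass haar x : ℝ≥0∞) = haar (MulAction.stabilizer Γ x : Set Γ) :=
  ENNReal.coe_toNNReal (hfin x).ne

section StabilizerMass

variable {Γ V : Type*} [Group Γ] [TopologicalSpace Γ] [IsTopologicalGroup Γ] [MeasurableSpace Γ]
  [BorelSpace Γ] [MulAction Γ V] {haar : Measure Γ}

variable [Countable V] [haar.IsMulLeftInvariant] [NeZero haar]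

theorem stabilizerMass_ne_zero (hfin : ∀ x : V, haar (MulAction.stabilizer Γ x : Set Γ) < ∞)
    (x : V) : stabilizerMass haar x ≠ 0 := by
  rw [← ENNReal.coe_ne_zero, coe_stabilizerMass hfin]
  simpa [pairMass] using pairMass_ne_zero haar x x

theorem stabilizerMass_smul_div
    (hmeas : ∀ x : V, MeasurableSet (MulAction.stabilizer Γ x : Set Γ))
    (hfin : ∀ x : V, haar (MulAction.stabilizer Γ x : Set Γ) < ∞) (γ : Γ) (x y : V) :
    stabilizerMass haar (γ • y) / stabilizerMass haar (γ • x) =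
      stabilizerMass haar y / stabilizerMass haar x := by
  rw [div_eq_div_iff (stabilizerMass_ne_zero hfin _) (stabilizerMass_ne_zero hfin _),
    ← ENNReal.coe_inj]
  push_cast
  simp only [coe_stabilizerMass hfin]
  rw [measure_stabilizer_smul_mul haar hmeas hfin, mul_comm]

end StabilizerMass

/-! ### Shift invariance of the total law -/

section TotalLaw

variable {Γ V Ξ : Type*} [MeasurableSpace V] [MeasurableSpace Ξ]

/-- The shift moves times and `Γ` moves values, so the two commute. -/
theorem measurable_shift_invariantSigma [Group Γ] [MulAction Γ V] [MulAction Γ Ξ] :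
    Measurable[invariantSigma Γ (Ξ × (ℤ → V)), invariantSigma Γ (Ξ × (ℤ → V))] shift :=
  fun A hA => ⟨measurable_shift hA.1, fun γ => by
    conv_rhs => rw [← hA.2 γ]
    rfl⟩

variable [Countable V] [MeasurableSingletonClass V] {q r : Ξ → V → V → ℝ≥0}

theorem isProbabilityMeasure_totalLaw {L : ℕ} (o : Fin L → V) {P : Measure Ξ} {ν : Ξ → V → ℝ≥0}
    (hν : Measurable fun a : Ξ × V => ν a.1 a.2) (hq : IsRandomEnvironment q)
    (hr : IsRandomEnvironment r) (h : ∑ i, ∫⁻ ξ, (ν ξ (o i) : ℝ≥0∞) ∂P = 1) :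
    IsProbabilityMeasure (totalLaw o P ν hq hr) := by
  refine ⟨?_⟩
  rw [totalLaw, Measure.finsetSum_apply, ← h]
  refine Finset.sum_congr rfl fun i _ => ?_
  rw [biasedLaw_apply hq hr hν _ MeasurableSet.univ]
  simp

/-- Mass transport along the first step of the walk. -/
theorem totalLaw_preimage_shift [Group Γ] [TopologicalSpace Γ] [IsTopologicalGroup Γ]
    [MeasurableSpace Γ] [BorelSpace Γ] {haar : Measure Γ} [haar.IsMulLeftInvariant] [NeZero haar]
    [MulAction Γ V] (hmeas : ∀ x : V, MeasurableSet (MulAction.stabilizer Γ x : Set Γ))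
    (hfin : ∀ x : V, haar (MulAction.stabilizer Γ x : Set Γ) < ∞)
    {L : ℕ} {o : Fin L → V} (ho : ∀ x : V, ∃! i, x ∈ MulAction.orbit Γ (o i))
    [MulAction Γ Ξ] [MeasurableConstSMul Γ Ξ] {P : Measure Ξ} [SMulInvariantMeasure Γ Ξ P]
    (hq : IsRandomEnvironment q) (hqΓ : IsInvariantEnvironment Γ q)
    (hr : IsRandomEnvironment r) (hrΓ : IsInvariantEnvironment Γ r)
    {ν : Ξ → V → ℝ≥0} (hν : Measurable fun a : Ξ × V => ν a.1 a.2)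
    (hνΓ : ∀ (γ : Γ) ξ x, ν (γ • ξ) (γ • x) = ν ξ x)
    (hbal : ∀ ξ x y, stabilizerMass haar x * ν ξ x * q ξ x y =
      stabilizerMass haar y * ν ξ y * r ξ y x)
    {A : Set (Ξ × (ℤ → V))} (hA : MeasurableSet[invariantSigma Γ (Ξ × (ℤ → V))] A) :
    totalLaw o P ν hq hr (shift ⁻¹' A) = totalLaw o P ν hq hr A := by
  have hAs : MeasurableSet[invariantSigma Γ (Ξ × (ℤ → V))] (shift ⁻¹' A) :=
    measurable_shift_invariantSigma hA
  have hev : ∀ n : ℤ, Measurable fun a : Ξ × (ℤ → V) => a.2 n := fun n =>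
    (measurable_pi_apply n).comp measurable_snd
  have hinv : ∀ {S : Set (Ξ × (ℤ → V))}, MeasurableSet[invariantSigma Γ (Ξ × (ℤ → V))] S →
      ∀ (n : ℤ) (γ : Γ) (x y : V),
        biasedLaw P ν hq hr (γ • x) (S ∩ {a | a.2 n = γ • y}) =
          biasedLaw P ν hq hr x (S ∩ {a | a.2 n = y}) := by
    intro S hS n γ x y
    have hm : MeasurableSet {a : Ξ × (ℤ → V) | a.2 n = γ • y} :=
      measurable_snd (measurableSet_eval_eq n (γ • y))
    rw [biasedLaw_smul hq hr hν hνΓ hqΓ hrΓ γ x (hS.1.inter hm), Set.preimage_inter, hS.2 γ]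
    congr 2
    ext a
    simp
  simp only [totalLaw, Measure.finsetSum_apply]
  simp_rw [← fun x => tsum_measure_inter_preimage_singleton (biasedLaw P ν hq hr x) (hev 1) hAs.1,
    ← fun x => tsum_measure_inter_preimage_singleton (biasedLaw P ν hq hr x) (hev (-1)) hA.1]
  refine mass_transport haar hmeas hfin ho
    (F := fun x y => biasedLaw P ν hq hr x (shift ⁻¹' A ∩ {a | a.2 1 = y}))
    (G := fun x y => biasedLaw P ν hq hr x (A ∩ {a | a.2 (-1) = y}))
    (hinv hAs 1) (hinv hA (-1)) fun x y => ?_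
  have h := biasedLaw_shift_eq (P := P) hq hr hν hbal x y hA.1
  rwa [coe_stabilizerMass hfin, coe_stabilizerMass hfin] at h

end TotalLaw

end TwoSidedWalk

open TwoSidedWalk in
theorem theorem5p2 {Γ V Ξ : Type*}
    -- a locally compact group with a left Haar measure
    [Group Γ] [TopologicalSpace Γ] [IsTopologicalGroup Γ] [LocallyCompactSpace Γ]
    [MeasurableSpace Γ] [BorelSpace Γ] (haar : Measure Γ) [haar.IsHaarMeasure]
    -- acting on a countable set, all stabilizers having finite Haar measure
    [Countable V] [MeasurableSpace V] [MeasurableSingletonClass V] [MulAction Γ V]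
    (hmeas : ∀ x : V, MeasurableSet (MulAction.stabilizer Γ x : Set Γ))
    (hfin : ∀ x : V, haar (MulAction.stabilizer Γ x : Set Γ) < ∞)
    -- with finitely many orbits, represented by `o`
    {L : ℕ} (o : Fin L → V) (ho : ∀ x : V, ∃! i, x ∈ MulAction.orbit Γ (o i))
    -- a measure-preserving dynamical system
    [MeasurableSpace Ξ] [MulAction Γ Ξ] [MeasurableConstSMul Γ Ξ]
    (P : Measure Ξ) [SMulInvariantMeasure Γ Ξ P]
    -- an invariant random environment and an invariant weight function
    (q : Ξ → V → V → ℝ≥0) (hq : IsRandomEnvironment q) (hqΓ : IsInvariantEnvironment Γ q)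
    (ν : Ξ → V → ℝ≥0) (hν : Measurable fun a : Ξ × V => ν a.1 a.2)
    (hνΓ : ∀ (γ : Γ) ξ x, ν (γ • ξ) (γ • x) = ν ξ x)
    (hstat : ∀ ξ, IsStationary (q ξ) fun x => stabilizerMass haar x * ν ξ x) :
    ∃ hrev : IsRandomEnvironment (reversal (stabilizerMass haar) ν q),
      IsInvariantEnvironment Γ (reversal (stabilizerMass haar) ν q) ∧
      @MeasurePreserving _ _ (invariantSigma Γ (Ξ × (ℤ → V))) (invariantSigma Γ (Ξ × (ℤ → V)))
        shift
        ((totalLaw o P ν hq hrev).trim (invariantSigma_le Γ (Ξ × (ℤ → V))))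
        ((totalLaw o P ν hq hrev).trim (invariantSigma_le Γ (Ξ × (ℤ → V)))) ∧
      (∑ i, ∫⁻ ξ, (ν ξ (o i) : ℝ≥0∞) ∂P = 1 →
        IsProbabilityMeasure (totalLaw o P ν hq hrev)) := by
  have hm := stabilizerMass_ne_zero hfin
  have hrev := isRandomEnvironment_reversal hm hq hν hstat
  have hrevΓ := isInvariantEnvironment_reversal (stabilizerMass_smul_div hmeas hfin) hqΓ hνΓ
  refine ⟨hrev, hrevΓ, ?_, isProbabilityMeasure_totalLaw o hν hq hrev⟩
  refine @MeasurePreserving.mk _ _ (_) (_) _ _ _ measurable_shift_invariantSigma ?_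
  -- On invariant events the trimmed measure is `totalLaw`, which reduces the claim to one event
  -- `A`.
  refine @Measure.ext _ (_) _ _ fun A hA => ?_
  rw [@Measure.map_apply _ _ (_) (_) _ _ measurable_shift_invariantSigma _ hA,
    trim_measurableSet_eq _ (measurable_shift_invariantSigma hA), trim_measurableSet_eq _ hA]
  exact totalLaw_preimage_shift hmeas hfin ho hq hqΓ hrev hrevΓ hν hνΓ
    (reversal_balance hm hstat) hA
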